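/- Let $F_0=0$, $F_1=1$, $F_{k}=F_{k-1}+F_{k-2}$ be the Fibonacci numbers. For a positive integer $N$, let $G_N$ be the simple graph with vertex set $\{1,2,\dots,N\}$ in which two distinct vertices $i\neq j$ are adjacent if and only if $i+j$ is a Fibonacci number, and let $\mathrm{Aut}(G_N)$ be its automorphism group. Let $n\geq 9$ be an integer divisible by $3$ (so that $F_{n-3}$, $F_n$ and $F_{n+3}$ are even), and let $N$ be an integer. (1) If $N\in\left[F_n,\tfrac32F_n\right)\cup\left[\tfrac12F_{n+3},\,F_{n+2}+\tfrac12F_{n-3}\right)\cup\left[F_{n+3}-\tfrac12F_n,\,F_{n+3}\right)$, then $\mathrm{Aut}(G_N)=\{\mathrm{id}\}$. (2) If $N\in\left[\tfrac32F_n,\,\tfrac12F_{n+3}\right)$, then $\mathrm{Aut}(G_N)=\{\mathrm{id},\phi\}$, where $\phi$ interchanges $\tfrac12F_n$ with $\tfrac32F_n$ and fixes all other vertices. (3) If $N\in\left[F_{n+2}+\tfrac12F_{n-3},\,F_{n+3}-\tfrac12F_n\right)$, then $\mathrm{Aut}(G_N)=\{\mathrm{id},\phi\}$, where $\phi$ interchanges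 $\tfrac12F_n$ with $\tfrac32F_n$, interchanges $F_{n+2}+\tfrac12F_{n-3}$ with $\tfrac12F_{n+3}$, and fixes all other vertices. Consequently, for every $N\geq 34$ the graph $G_N$ has at most one non-trivial automorphism. -/

import Mathlib

/-- The Fibonacci-sum graph `G_N`: its vertices are `1, …, N`, and distinct vertices `i`, `j` are
adjacent if and only if `i + j` is a Fibonacci number. -/
def fibSumGraph (N : ℕ) : SimpleGraph (Finset.Icc 1 N) where
  Adj i j := i ≠ j ∧ ∃ k : ℕ, Nat.fib k = (i : ℕ) + (j : ℕ)
  symm := ⟨fun _ _ h => ⟨h.1.symm, h.2.imp fun _ hk => hk.trans (Nat.add_comm _ _)⟩⟩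
  loopless := ⟨fun _ h => h.1 rfl⟩

/-- The automorphism group of `G_N`. -/
abbrev FibSumAut (N : ℕ) : Type := fibSumGraph N ≃g fibSumGraph N

/-- Fibonacci numbers whose index is divisible by `3` are even, so the halves `Nat.fib n / 2`,
`Nat.fib (n + 3) / 2` and `Nat.fib (n - 3) / 2` in the statement are exact. -/
theorem two_mul_fib_div_two {n : ℕ} (h : 3 ∣ n) : 2 * (Nat.fib n / 2) = Nat.fib n :=
  Nat.mul_div_cancel' (Nat.fib_dvd 3 n h)

/-! Write `F_k ≤ v < F_{k+1}` and `F_K ≤ v + N < F_{K+1}`. The neighbours of `v` are the `F_j - v`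
with `k < j ≤ K`, so `v` has degree `K - k`, less one if `2v` is a Fibonacci number
(`sumDeg_add_half`). Degrees therefore almost determine the Fibonacci block of a vertex.

Let `i` be the least vertex moved by a non-trivial automorphism `g`. It is not `1`
(`IsAut.map_one`), so `F_{e+3} ≤ i < F_{e+4}` for some `e`. The neighbour `a = F_{e+4} - i` is
smaller than `i`, hence fixed, and `g i = F_l - a` for some `l > e + 4`. Comparing degrees and
pulling edges back through `g` leaves only `2i = F_{e+5}` and `g i = 3i`, with `N` in one of two
ranges (`FirstMoved.exists_swapRange`).

The index `n = e + 5` is determined by `N`. All non-trivial automorphisms thus agree at `F_n / 2`,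
and a quotient of two of them, fixing that vertex, must be trivial (`IsAut.eq_of_ne_one`). In both
ranges an explicit involution is an automorphism (`isAut_swap`, `isAut_double_swap`). The argument
runs on permutations of `ℕ` and is transferred to the graph at the end. -/

/-! ### Automorphisms as permutations of `ℕ`. -/

/-- Adjacency in `G_N`, as a relation on natural numbers. -/
def SumAdj (N u v : ℕ) : Prop :=
  1 ≤ u ∧ u ≤ N ∧ 1 ≤ v ∧ v ≤ N ∧ u ≠ v ∧ ∃ k, Nat.fib k = u + v

theorem SumAdj.symm {N u v : ℕ} (h : SumAdj N u v) : SumAdj N v u := by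
  obtain ⟨h1, h2, h3, h4, h5, k, hk⟩ := h
  exact ⟨h3, h4, h1, h2, h5.symm, k, by omega⟩

/-- A permutation of `ℕ` that fixes everything outside `[1, N]` and preserves the edges of `G_N`. -/
def IsAut (N : ℕ) (g : Equiv.Perm ℕ) : Prop :=
  (∀ u v, SumAdj N u v ↔ SumAdj N (g u) (g v)) ∧ ∀ u, ¬(1 ≤ u ∧ u ≤ N) → g u = u

theorem IsAut.mem {N : ℕ} {g : Equiv.Perm ℕ} (hg : IsAut N g) {u : ℕ} (h1 : 1 ≤ u) (h2 : u ≤ N) :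
    1 ≤ g u ∧ g u ≤ N := by
  by_contra h
  have := g.injective (hg.2 _ h)
  rw [this] at h
  exact h ⟨h1, h2⟩

theorem IsAut.inv {N : ℕ} {g : Equiv.Perm ℕ} (hg : IsAut N g) : IsAut N g⁻¹ := by
  refine ⟨fun u v => ?_, fun u hu => ?_⟩
  · rw [hg.1 (g⁻¹ u) (g⁻¹ v)]
    simp
  · rw [Equiv.Perm.inv_eq_iff_eq]
    exact (hg.2 u hu).symm

theorem IsAut.mul {N : ℕ} {g h : Equiv.Perm ℕ} (hg : IsAut N g) (hh : IsAut N h) :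
    IsAut N (g * h) := by
  refine ⟨fun u v => ?_, fun u hu => ?_⟩
  · rw [hh.1 u v, hg.1]
    simp
  · rw [Equiv.Perm.mul_apply, hh.2 u hu, hg.2 u hu]

/-- A neighbour of `g u` is the image of a neighbour of `u`. -/
theorem IsAut.exists_preimage {N : ℕ} {g : Equiv.Perm ℕ} (hg : IsAut N g) {u y : ℕ}
    (h : SumAdj N (g u) y) : ∃ x, g x = y ∧ SumAdj N u x :=
  ⟨g.symm y, by simp, by rw [hg.1]; simpa using h⟩

/-! ### Degrees. -/

/-- The degree of a vertex of `G_N`. -/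
noncomputable def sumDeg (N u : ℕ) : ℕ := {v | SumAdj N u v}.ncard

theorem IsAut.sumDeg_eq {N : ℕ} {g : Equiv.Perm ℕ} (hg : IsAut N g) (u : ℕ) :
    sumDeg N (g u) = sumDeg N u := by
  unfold sumDeg
  rw [← Set.ncard_image_of_injective {v | SumAdj N u v} g.injective]
  congr 1
  ext v
  constructor
  · intro h
    obtain ⟨x, hx, hx'⟩ := hg.exists_preimage h
    exact ⟨x, hx', hx⟩
  · rintro ⟨x, hx, rfl⟩
    exact (hg.1 _ _).1 hx

theorem lt_of_fib_lt {a b : ℕ} (h : Nat.fib a < Nat.fib b) : a < b := by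
  by_contra hc
  exact absurd (Nat.fib_mono (not_lt.1 hc)) (not_le.2 h)

theorem fib_lt_of_lt {a b : ℕ} (ha : 2 ≤ a) (h : a < b) : Nat.fib a < Nat.fib b :=
  lt_of_lt_of_le (Nat.fib_lt_fib_succ ha) (Nat.fib_mono h)

theorem exists_fib_bracket {v : ℕ} (hv : 1 ≤ v) :
    ∃ k, 2 ≤ k ∧ Nat.fib k ≤ v ∧ v < Nat.fib (k + 1) := by
  refine ⟨Nat.greatestFib v, ?_, Nat.fib_greatestFib_le v, Nat.lt_fib_greatestFib_add_one v⟩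
  exact Nat.le_greatestFib.2 (by simpa using hv)

theorem sumDeg_ne_zero {N u v : ℕ} (h : SumAdj N u v) : 1 ≤ sumDeg N u := by
  have hf : {v | SumAdj N u v}.Finite :=
    (Set.finite_Icc 1 N).subset fun x hx => ⟨hx.2.2.1, hx.2.2.2.1⟩
  exact (Set.ncard_pos hf).2 ⟨v, h⟩

-- Sums `F_j` with `k < j ≤ K` are those lying above `v` and at most `v + N`. Each gives one
-- neighbour `F_j - v`, except that `F_j = 2v` would be a loop; the conditional term counts it.
open Classical in
theorem sumDeg_add_half {N v k K : ℕ} (hv : v ≤ N) (hk2 : 2 ≤ k)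
    (hk : Nat.fib k ≤ v) (hk' : v < Nat.fib (k + 1)) (hK : Nat.fib K ≤ v + N)
    (hK' : v + N < Nat.fib (K + 1)) :
    sumDeg N v + (if ∃ j, Nat.fib j = 2 * v then 1 else 0) = K - k := by
  have hpos : 1 ≤ v := le_trans (Nat.fib_pos.2 (by omega)) hk
  have hset : {u | SumAdj N v u} =
      (((Finset.Ioc k K).filter fun j => Nat.fib j ≠ 2 * v).image fun j => Nat.fib j - v :
        Finset ℕ) := by
    ext u
    simp only [Set.mem_ofPred_eq, Finset.coe_image, Finset.coe_filter, Finset.mem_Ioc,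
      Set.mem_image]
    constructor
    · rintro ⟨_, _, h3, h4, h5, j, hj⟩
      refine ⟨j, ⟨⟨lt_of_fib_lt (by omega), ?_⟩, by omega⟩, by omega⟩
      exact Nat.le_of_lt_add_one (lt_of_fib_lt (by omega))
    · rintro ⟨j, ⟨⟨hj1, hj2⟩, hj3⟩, rfl⟩
      have h1 := Nat.fib_mono (show k + 1 ≤ j from hj1)
      have h2 := Nat.fib_mono hj2
      exact ⟨hpos, hv, by omega, by omega, by omega, j, by omega⟩
  have hcard : sumDeg N v = ((Finset.Ioc k K).filter fun j => Nat.fib j ≠ 2 * v).card := by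
    unfold sumDeg
    rw [hset, Set.ncard_coe_finset, Finset.card_image_of_injOn]
    intro x hx y hy hxy
    simp only [Finset.coe_filter, Finset.mem_Ioc, Set.mem_ofPred_eq] at hx hy hxy
    have h1 := Nat.fib_mono (show k + 1 ≤ x from hx.1.1)
    have h2 := Nat.fib_mono (show k + 1 ≤ y from hy.1.1)
    rcases lt_trichotomy x y with h | h | h
    · have := fib_lt_of_lt (by omega) h
      omega
    · exact h
    · have := fib_lt_of_lt (by omega) h
      omega
  rw [hcard]
  split_ifs with h
  · obtain ⟨j, hj⟩ := h
    have hmem : j ∈ Finset.Ioc k K := by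
      rw [Finset.mem_Ioc]
      exact ⟨lt_of_fib_lt (by omega), Nat.le_of_lt_add_one (lt_of_fib_lt (by omega))⟩
    have : ((Finset.Ioc k K).filter fun j => Nat.fib j ≠ 2 * v) = (Finset.Ioc k K).erase j := by
      ext x
      rw [Finset.mem_filter, Finset.mem_erase, and_comm]
      refine and_congr_left fun hx => not_congr ⟨fun h => ?_, fun h => h ▸ hj⟩
      rw [Finset.mem_Ioc] at hx
      rw [Finset.mem_Ioc] at hmem
      rcases lt_trichotomy x j with h' | h' | h'
      · have := fib_lt_of_lt (by omega) h'
        omega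
      · exact h'
      · have := fib_lt_of_lt (by omega) h'
        omega
    rw [this, Finset.card_erase_add_one hmem, Nat.card_Ioc]
  · rw [Finset.filter_true_of_mem (p := fun j => Nat.fib j ≠ 2 * v) fun x _ hx => h ⟨x, hx⟩,
      Nat.card_Ioc, add_zero]

theorem sumDeg_of_half {N v k K j : ℕ} (hv : v ≤ N) (hk2 : 2 ≤ k)
    (hk : Nat.fib k ≤ v) (hk' : v < Nat.fib (k + 1)) (hK : Nat.fib K ≤ v + N)
    (hK' : v + N < Nat.fib (K + 1)) (hj : Nat.fib j = 2 * v) : sumDeg N v + 1 = K - k := by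
  rw [← sumDeg_add_half hv hk2 hk hk' hK hK', if_pos ⟨j, hj⟩]

theorem sumDeg_of_not_half {N v k K : ℕ} (hv : v ≤ N) (hk2 : 2 ≤ k)
    (hk : Nat.fib k ≤ v) (hk' : v < Nat.fib (k + 1)) (hK : Nat.fib K ≤ v + N)
    (hK' : v + N < Nat.fib (K + 1)) (hj : ∀ j, Nat.fib j ≠ 2 * v) : sumDeg N v = K - k := by
  rw [← sumDeg_add_half hv hk2 hk hk' hK hK', if_neg (by simpa using hj), add_zero]

theorem sumDeg_le {N v k K : ℕ} (hv : v ≤ N) (hk2 : 2 ≤ k)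
    (hk : Nat.fib k ≤ v) (hk' : v < Nat.fib (k + 1)) (hK : Nat.fib K ≤ v + N)
    (hK' : v + N < Nat.fib (K + 1)) : sumDeg N v ≤ K - k := by
  rw [← sumDeg_add_half hv hk2 hk hk' hK hK']
  omega

/-- If `F_m ≤ N < F_{m+1}`, the largest Fibonacci number up to `v + N` has index at most `m + 2`. -/
theorem exists_top_index {N m v : ℕ} (hm : Nat.fib m ≤ N)
    (hm' : N < Nat.fib (m + 1)) (hv : v ≤ N) :
    ∃ K, Nat.fib K ≤ v + N ∧ v + N < Nat.fib (K + 1) ∧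
      (K = m ∧ v + N < Nat.fib (m + 1) ∨
        K = m + 1 ∧ Nat.fib (m + 1) ≤ v + N ∧ v + N < Nat.fib (m + 2) ∨
        K = m + 2 ∧ Nat.fib (m + 2) ≤ v + N) := by
  have e2 := Nat.fib_add_two (n := m)
  have e3 := Nat.fib_add_two (n := m + 1)
  have e4 := Nat.fib_add_two (n := m + 2)
  simp only [add_assoc, Nat.reduceAdd] at e2 e3 e4
  by_cases h1 : v + N < Nat.fib (m + 1)
  · exact ⟨m, by omega, h1, Or.inl ⟨rfl, h1⟩⟩
  by_cases h2 : v + N < Nat.fib (m + 2)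
  · exact ⟨m + 1, by omega, h2, Or.inr (Or.inl ⟨rfl, by omega, h2⟩)⟩
  · exact ⟨m + 2, by omega, by simp only [add_assoc, Nat.reduceAdd]; omega,
      Or.inr (Or.inr ⟨rfl, by omega⟩)⟩

/-- Only the Fibonacci number two blocks up can be twice a given vertex. -/
theorem half_index {v k j : ℕ} (hk3 : 3 ≤ k) (hk : Nat.fib k ≤ v) (hk' : v < Nat.fib (k + 1))
    (hj : Nat.fib j = 2 * v) : j = k + 2 := by
  obtain ⟨e, rfl⟩ : ∃ e, k = e + 3 := ⟨k - 3, by omega⟩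
  have e2 := Nat.fib_add_two (n := e + 1)
  have e3 := Nat.fib_add_two (n := e + 2)
  have e4 := Nat.fib_add_two (n := e + 3)
  have e5 := Nat.fib_add_two (n := e + 4)
  have hp := Nat.fib_pos.2 (show 0 < e + 1 by omega)
  simp only [add_assoc, Nat.reduceAdd] at e2 e3 e4 e5 hk hk' ⊢
  have h1 : e + 4 < j := lt_of_fib_lt (by omega)
  have h2 : j < e + 6 := lt_of_fib_lt (by omega)
  omega

/-- Apply `gcd (F_3, F_n) = F_{gcd (3, n)}` with `F_3 = 2`. -/
theorem three_dvd_of_fib_even {n v : ℕ} (h : Nat.fib n = 2 * v) : 3 ∣ n := by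
  have h1 := Nat.fib_gcd 3 n
  rw [h, show Nat.fib 3 = 2 from rfl, Nat.gcd_mul_right_right] at h1
  rcases (Nat.dvd_prime Nat.prime_three).1 (Nat.gcd_dvd_left 3 n) with h2 | h2
  · rw [h2] at h1
    simp at h1
  · exact Nat.gcd_eq_left_iff_dvd.1 h2

theorem fib_le_fourteen {j : ℕ} (h : Nat.fib j ≤ 14) :
    Nat.fib j = 0 ∨ Nat.fib j = 1 ∨ Nat.fib j = 2 ∨ Nat.fib j = 3 ∨ Nat.fib j = 5 ∨
      Nat.fib j = 8 ∨ Nat.fib j = 13 := by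
  have hj : j < 8 := lt_of_fib_lt (lt_of_le_of_lt h (by decide))
  interval_cases j <;> decide

theorem sum_cases_of_sumAdj {N u v : ℕ} (h : SumAdj N u v) (huv : u + v ≤ 14) :
    u + v = 0 ∨ u + v = 1 ∨ u + v = 2 ∨ u + v = 3 ∨ u + v = 5 ∨ u + v = 8 ∨ u + v = 13 := by
  obtain ⟨_, _, _, _, _, j, hj⟩ := h
  rw [← hj] at huv ⊢
  exact fib_le_fourteen huv

theorem exists_block {N : ℕ} (hN : 34 ≤ N) :
    ∃ m, 9 ≤ m ∧ Nat.fib m ≤ N ∧ N < Nat.fib (m + 1) := by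
  obtain ⟨m, _, hm, hm'⟩ := exists_fib_bracket (v := N) (by omega)
  refine ⟨m, ?_, hm, hm'⟩
  exact Nat.le_of_lt_add_one (lt_of_fib_lt (lt_of_le_of_lt (show Nat.fib 9 ≤ N from hN) hm'))

/-! ### Small vertices, and the vertex `1`. -/

/-- `1` if `F_{m+1}` is one of the sums reachable from `v` inside `[1, N]`, and `0` otherwise. -/
def topBit (N m v : ℕ) : ℕ := if Nat.fib (m + 1) ≤ v + N then 1 else 0

theorem topBit_le_one (N m v : ℕ) : topBit N m v ≤ 1 := by
  unfold topBit
  split_ifs <;> omega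

theorem topBit_mono (N m : ℕ) {u v : ℕ} (h : u ≤ v) : topBit N m u ≤ topBit N m v := by
  unfold topBit
  split_ifs <;> omega

/-- The degree of a vertex far below `N`, up to the defect at halves of Fibonacci numbers. -/
theorem sumDeg_small {N m k v : ℕ} (hkm : k ≤ m) (hm : Nat.fib m ≤ N)
    (hm' : N < Nat.fib (m + 1)) (hvm : v < Nat.fib m) (hk2 : 2 ≤ k)
    (hk : Nat.fib k ≤ v) (hk' : v < Nat.fib (k + 1)) :
    ((∃ j, Nat.fib j = 2 * v) → sumDeg N v + 1 + k = m + topBit N m v) ∧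
      ((∀ j, Nat.fib j ≠ 2 * v) → sumDeg N v + k = m + topBit N m v) := by
  have hv : v ≤ N := by omega
  have e2 := Nat.fib_add_two (n := m)
  obtain ⟨K, hK, hK', hc⟩ := exists_top_index hm hm' hv
  have hKm : K = m + topBit N m v := by
    unfold topBit
    split_ifs <;> omega
  refine ⟨fun ⟨j, hj⟩ => ?_, fun h => ?_⟩
  · have := sumDeg_of_half hv hk2 hk hk' hK hK' hj
    omega
  · have := sumDeg_of_not_half hv hk2 hk hk' hK hK' h
    omega

theorem sumDeg_le_of_eight_le {N m v : ℕ} (hm9 : 9 ≤ m) (hm : Nat.fib m ≤ N)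
    (hm' : N < Nat.fib (m + 1)) (hv8 : 8 ≤ v) (hv : v ≤ N) : sumDeg N v + 5 ≤ m := by
  obtain ⟨K, hK, hK', hc⟩ := exists_top_index hm hm' hv
  obtain ⟨k, hk2, hk, hk'⟩ := exists_fib_bracket (v := v) (by omega)
  have h6 : 6 < k + 1 := lt_of_fib_lt (lt_of_le_of_lt (show Nat.fib 6 ≤ v from hv8) hk')
  have hd := sumDeg_le hv hk2 hk hk' hK hK'
  have e2 := Nat.fib_add_two (n := m)
  by_cases hvm : v < Nat.fib m
  · omega
  · have : m < k + 1 := lt_of_fib_lt (by omega)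
    omega

/-- Every automorphism fixes the vertex `1`. -/
theorem IsAut.map_one {N : ℕ} {g : Equiv.Perm ℕ} (hN : 34 ≤ N) (hg : IsAut N g) : g 1 = 1 := by
  obtain ⟨m, hm9, hm, hm'⟩ := exists_block hN
  have h34 : 34 ≤ Nat.fib m := Nat.fib_mono hm9
  have nf : ∀ c, c ≤ 14 → c ≠ 0 ∧ c ≠ 1 ∧ c ≠ 2 ∧ c ≠ 3 ∧ c ≠ 5 ∧ c ≠ 8 ∧ c ≠ 13 →
      ∀ j, Nat.fib j ≠ c := by
    intro c hc hc' j hj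
    have := fib_le_fourteen (j := j) (by omega)
    omega
  have f6 : Nat.fib 6 = 8 := rfl
  have f5 : Nat.fib 5 = 5 := rfl
  have f4 : Nat.fib 4 = 3 := rfl
  have f3 : Nat.fib 3 = 2 := rfl
  have f2 : Nat.fib 2 = 1 := rfl
  obtain ⟨d1, -⟩ := sumDeg_small (v := 1) (k := 2) (by omega) hm hm' (by omega) le_rfl
    (by norm_num) (by norm_num)
  obtain ⟨-, d2⟩ := sumDeg_small (v := 2) (k := 3) (by omega) hm hm' (by omega) (by omega)
    (by omega) (by norm_num)
  obtain ⟨-, d3⟩ := sumDeg_small (v := 3) (k := 4) (by omega) hm hm' (by omega) (by omega)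
    (by omega) (by norm_num)
  obtain ⟨d4, -⟩ := sumDeg_small (v := 4) (k := 4) (by omega) hm hm' (by omega) (by omega)
    (by omega) (by norm_num)
  obtain ⟨-, d5⟩ := sumDeg_small (v := 5) (k := 5) (by omega) hm hm' (by omega) (by omega)
    (by omega) (by norm_num)
  obtain ⟨-, d6⟩ := sumDeg_small (v := 6) (k := 5) (by omega) hm hm' (by omega) (by omega)
    (by omega) (by norm_num)
  obtain ⟨-, d7⟩ := sumDeg_small (v := 7) (k := 5) (by omega) hm hm' (by omega) (by omega)
    (by omega) (by norm_num)
  replace d1 := d1 ⟨3, by omega⟩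
  replace d2 := d2 (nf _ (by omega) (by omega))
  replace d3 := d3 (nf _ (by omega) (by omega))
  replace d4 := d4 ⟨6, by omega⟩
  replace d5 := d5 (nf _ (by omega) (by omega))
  replace d6 := d6 (nf _ (by omega) (by omega))
  replace d7 := d7 (nf _ (by omega) (by omega))
  have c1 := topBit_mono N m (show 1 ≤ 2 by omega)
  have c2 := topBit_mono N m (show 2 ≤ 3 by omega)
  have c3 := topBit_mono N m (show 3 ≤ 4 by omega)
  have c4 := topBit_mono N m (show 4 ≤ 5 by omega)
  have c5 := topBit_mono N m (show 5 ≤ 6 by omega)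
  have c6 := topBit_mono N m (show 6 ≤ 7 by omega)
  have c7 := topBit_le_one N m 7
  -- Up to the top bit, the vertices `1, …, 7` have degrees `m-3, m-3, m-4, m-5, m-5, m-5, m-5` (`1`
  -- and `4` lose one as halves of `2` and `8`), and every later vertex has degree at most `m-5`.
  have small : ∀ u, 1 ≤ u → u ≤ N → m ≤ sumDeg N u + 4 → g u = 1 ∨ g u = 2 ∨ g u = 3 ∨ g u = 4 ∨
      g u = 5 ∨ g u = 6 ∨ g u = 7 := by
    intro u h1 h2 h3
    have hmem := hg.mem h1 h2
    rw [← hg.sumDeg_eq] at h3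
    by_contra hc
    have := sumDeg_le_of_eight_le hm9 hm hm' (show 8 ≤ g u by omega) hmem.2
    omega
  have tiny : ∀ u, 1 ≤ u → u ≤ N → m ≤ sumDeg N u + 3 → g u = 1 ∨ g u = 2 ∨ g u = 3 := by
    intro u h1 h2 h3
    have := small u h1 h2 (by omega)
    rw [← hg.sumDeg_eq] at h3
    rcases this with h | h | h | h | h | h | h <;> rw [h] at h3 <;> omega
  have E1 := hg.sumDeg_eq 1
  have E2 := hg.sumDeg_eq 2
  have E3 := hg.sumDeg_eq 3
  have E4 := hg.sumDeg_eq 4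
  have E5 := hg.sumDeg_eq 5
  have E7 := hg.sumDeg_eq 7
  have inj : ∀ x y, g x = g y → x = y := fun x y h => g.injective h
  have a12 : SumAdj N (g 1) (g 2) := (hg.1 1 2).1 ⟨by omega, by omega, by omega, by omega,
    by omega, 4, by omega⟩
  have a23 : SumAdj N (g 2) (g 3) := (hg.1 2 3).1 ⟨by omega, by omega, by omega, by omega,
    by omega, 5, by omega⟩
  have a35 : SumAdj N (g 3) (g 5) := (hg.1 3 5).1 ⟨by omega, by omega, by omega, by omega,
    by omega, 6, by omega⟩
  have a14 : SumAdj N (g 1) (g 4) := (hg.1 1 4).1 ⟨by omega, by omega, by omega, by omega,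
    by omega, 5, by omega⟩
  have a17 : SumAdj N (g 1) (g 7) := (hg.1 1 7).1 ⟨by omega, by omega, by omega, by omega,
    by omega, 6, by omega⟩
  have t2 := tiny 2 (by omega) (by omega) (by omega)
  rcases tiny 1 (by omega) (by omega) (by omega) with h1 | h1 | h1
  · exact h1
  · exfalso
    rw [h1] at E1 a12
    have n21 := inj 2 1
    rcases t2 with h2 | h2 | h2
    · rw [h2] at a23 E2
      have b := a23.2.2.2.2.1
      have n31 := inj 3 1
      rcases small 3 (by omega) (by omega) (by omega) with h3 | h3 | h3 | h3 | h3 | h3 | h3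
      · omega
      · omega
      · rw [h3] at a23
        have := sum_cases_of_sumAdj a23 (by omega)
        omega
      · rw [h3] at E3 a35
        have s5 := small 5 (by omega) (by omega) (by omega)
        have := sum_cases_of_sumAdj a35 (by omega)
        have := a35.2.2.2.2.1
        have := inj 5 2
        omega
      · rw [h3] at a23
        have := sum_cases_of_sumAdj a23 (by omega)
        omega
      · rw [h3] at a23
        have := sum_cases_of_sumAdj a23 (by omega)
        omega
      -- Here `6` is a common neighbour of `g 3 = 7` and `g 1 = 2`. Its preimage `x` makes `x + 3`
      -- and `x + 1` both Fibonacci, so `x = 2`, whose image is `1`.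
      · have a36 : SumAdj N (g 3) 6 := by
          rw [h3]
          exact ⟨by omega, by omega, by omega, by omega, by omega, 7, rfl⟩
        have a16 : SumAdj N (g 1) 6 := by
          rw [h1]
          exact ⟨by omega, by omega, by omega, by omega, by omega, 6, rfl⟩
        obtain ⟨x, hx, hx3⟩ := hg.exists_preimage a36
        obtain ⟨y, hy, hx1⟩ := hg.exists_preimage a16
        obtain rfl := inj x y (by omega)
        obtain ⟨_, _, hxp, _, _, s, hs⟩ := hx3
        obtain ⟨_, _, _, _, _, t, ht⟩ := hx1
        have hts : t < s := lt_of_fib_lt (by omega)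
        obtain ⟨r, rfl⟩ : ∃ r, s = r + 2 := ⟨s - 2, by
          have : 4 < s := lt_of_fib_lt (by omega)
          omega⟩
        have e := Nat.fib_add_two (n := r)
        have := Nat.fib_mono (show t ≤ r + 1 by omega)
        have hr : r < 4 := lt_of_fib_lt (by omega)
        have hr' : 4 < r + 2 := lt_of_fib_lt (by omega)
        obtain rfl : r = 3 := by omega
        have : x = 2 := by
          have : Nat.fib (3 + 2) = 5 := rfl
          omega
        subst this
        omega
    · have := inj 2 1
      omega
    · rw [h2] at a23 E2
      rcases tiny 3 (by omega) (by omega) (by omega) with h3 | h3 | h3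
      · rw [h3] at a23
        have := sum_cases_of_sumAdj a23 (by omega)
        omega
      · have := inj 3 1
        omega
      · have := inj 3 2
        omega
  · exfalso
    rw [h1] at E1 a12 a14 a17
    have h2 : g 2 = 2 := by
      have := inj 2 1
      rcases t2 with h2 | h2 | h2
      · rw [h2] at a12
        have := sum_cases_of_sumAdj a12 (by omega)
        omega
      · exact h2
      · omega
    have s4 := small 4 (by omega) (by omega) (by omega)
    have s7 := small 7 (by omega) (by omega) (by omega)
    have := sum_cases_of_sumAdj a14 (by omega)
    have := sum_cases_of_sumAdj a17 (by omega)
    have := inj 4 2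
    have := inj 7 2
    have := inj 4 7
    omega

/-! ### Additive equations between Fibonacci numbers. -/

theorem fib_add_fib_le {t s : ℕ} (h : t < s + 2) : Nat.fib t + Nat.fib s ≤ Nat.fib (s + 2) := by
  have h1 := Nat.fib_mono (show t ≤ s + 1 by omega)
  have h2 := Nat.fib_add_two (n := s)
  omega

theorem eq_of_fib_eq {s t : ℕ} (ht : 2 ≤ t) (hs : 2 ≤ s) (h : Nat.fib s = Nat.fib t) : s = t := by
  rcases lt_trichotomy s t with h' | h' | h'
  · have := fib_lt_of_lt hs h'
    omega
  · exact h'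
  · have := fib_lt_of_lt ht h'
    omega

/-- `F_{c+2} + F_t` is a Fibonacci number only if `F_t` is `F_{c+1}` or `F_{c+3}`. -/
theorem fib_eq_fib_add {c t u : ℕ} (ht0 : 0 < Nat.fib t)
    (h : Nat.fib u = Nat.fib (c + 2) + Nat.fib t) :
    Nat.fib t = Nat.fib (c + 1) ∨ Nat.fib t = Nat.fib (c + 3) := by
  have e3 : Nat.fib (c + 3) = Nat.fib (c + 1) + Nat.fib (c + 2) := Nat.fib_add_two
  have e4 : Nat.fib (c + 4) = Nat.fib (c + 2) + Nat.fib (c + 3) := Nat.fib_add_two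
  have h1 := Nat.fib_pos.2 (show 0 < c + 1 by omega)
  have h2 := Nat.fib_pos.2 (show 0 < c + 2 by omega)
  have htu : t < u := lt_of_fib_lt (by omega)
  have hu1 : c + 2 < u := lt_of_fib_lt (by omega)
  obtain ⟨r, rfl⟩ : ∃ r, u = r + 2 := ⟨u - 2, by omega⟩
  have h3 := fib_add_fib_le htu
  have hr : r < c + 3 := lt_of_fib_lt (by omega)
  obtain rfl | rfl : r = c + 1 ∨ r = c + 2 := by omega
  · left
    simp only [add_assoc, Nat.reduceAdd] at h
    omega
  · right
    simp only [add_assoc, Nat.reduceAdd] at h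
    omega

/-- The only solution of `F_p = F_q + 2 F_{c+2}` with `p ≥ c + 4` is
`F_{c+4} = F_{c+1} + 2 F_{c+2}`. -/
theorem fib_eq_add_two_mul_fib {c p q : ℕ} (hc : 1 ≤ c) (hp : c + 4 ≤ p)
    (h : Nat.fib p = Nat.fib q + 2 * Nat.fib (c + 2)) : p = c + 4 := by
  have e2 : Nat.fib (c + 2) = Nat.fib c + Nat.fib (c + 1) := Nat.fib_add_two
  have e3 : Nat.fib (c + 3) = Nat.fib (c + 1) + Nat.fib (c + 2) := Nat.fib_add_two
  have e4 : Nat.fib (c + 4) = Nat.fib (c + 2) + Nat.fib (c + 3) := Nat.fib_add_two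
  have e5 : Nat.fib (c + 5) = Nat.fib (c + 3) + Nat.fib (c + 4) := Nat.fib_add_two
  have h0 := Nat.fib_pos.2 (show 0 < c by omega)
  have h1 := Nat.fib_pos.2 (show 0 < c + 1 by omega)
  have hqp : q < p := lt_of_fib_lt (by omega)
  obtain ⟨r, rfl⟩ : ∃ r, p = r + 2 := ⟨p - 2, by omega⟩
  have h4 := fib_add_fib_le hqp
  have hr : r < c + 4 := lt_of_fib_lt (by omega)
  by_contra hne
  obtain rfl : r = c + 3 := by omega
  simp only [add_assoc, Nat.reduceAdd] at h
  have hq1 : c + 3 < q := lt_of_fib_lt (by omega)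
  have hq2 : q < c + 4 := lt_of_fib_lt (by omega)
  omega

/-- The only solution of `F_s + F_t = F_r + F_c` with `s ≥ c + 2` and `t ≠ c` is
`F_{c+2} + F_{c+2} = F_{c+3} + F_c`. -/
theorem fib_add_fib_eq {c s t r : ℕ} (hc : 3 ≤ c) (hs : c + 2 ≤ s) (ht0 : 0 < Nat.fib t)
    (htc : t ≠ c) (h : Nat.fib s + Nat.fib t = Nat.fib r + Nat.fib c) : t = c + 2 := by
  rcases lt_or_gt_of_ne htc with h' | h'
  · have h1 := Nat.fib_mono (show t ≤ c - 1 by omega)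
    have h2 := fib_lt_of_lt (show 2 ≤ c - 1 by omega) (show c - 1 < c by omega)
    have h3 : r < s := lt_of_fib_lt (by omega)
    obtain ⟨p, rfl⟩ : ∃ p, s = p + 2 := ⟨s - 2, by omega⟩
    have h4 := fib_add_fib_le h3
    have h5 := Nat.fib_mono (show c ≤ p by omega)
    omega
  · have h1 := fib_lt_of_lt (show 2 ≤ c by omega) h'
    have h2 := fib_lt_of_lt (show 2 ≤ c by omega) (show c < s by omega)
    have h0 := Nat.fib_pos.2 (show 0 < c by omega)
    have h3 : s < r := lt_of_fib_lt (by omega)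
    have h3' : t < r := lt_of_fib_lt (by omega)
    obtain ⟨p, rfl⟩ : ∃ p, r = p + 2 := ⟨r - 2, by omega⟩
    have h4 := fib_add_fib_le h3
    have h4' := fib_add_fib_le h3'
    have h5 : p < t := lt_of_fib_lt (by omega)
    have h5' : p < s := lt_of_fib_lt (by omega)
    -- Both `s` and `t` lie strictly between `r - 2` and `r`, so both equal `r - 1`; then `2 F_s =
    -- F_{s+1} + F_{s-2}` gives `s - 2 = c`.
    obtain rfl : s = t := by omega
    obtain ⟨q, rfl⟩ : ∃ q, s = q + 2 := ⟨s - 2, by omega⟩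
    obtain rfl : p = q + 1 := by omega
    have e2q : Nat.fib (q + 2) = Nat.fib q + Nat.fib (q + 1) := Nat.fib_add_two
    have e3q : Nat.fib (q + 1 + 2) = Nat.fib (q + 1) + Nat.fib (q + 2) := Nat.fib_add_two
    have := eq_of_fib_eq (s := q) (t := c) (by omega) (by omega) (by omega)
    omega

theorem sumDeg_cases {N v k K : ℕ} (hv : v ≤ N) (hk3 : 3 ≤ k)
    (hk : Nat.fib k ≤ v) (hk' : v < Nat.fib (k + 1)) (hK : Nat.fib K ≤ v + N)
    (hK' : v + N < Nat.fib (K + 1)) :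
    Nat.fib (k + 2) = 2 * v ∧ sumDeg N v + 1 = K - k ∨
      Nat.fib (k + 2) ≠ 2 * v ∧ sumDeg N v = K - k := by
  by_cases h : Nat.fib (k + 2) = 2 * v
  · exact Or.inl ⟨h, sumDeg_of_half hv (by omega) hk hk' hK hK' h⟩
  · refine Or.inr ⟨h, sumDeg_of_not_half hv (by omega) hk hk' hK hK' fun j hj => h ?_⟩
    rwa [half_index hk3 hk hk' hj] at hj

/-! ### The least moved vertex. -/

/-- `i` is the least vertex moved by the automorphism `g`, and `F_{e+3} ≤ i < F_{e+4}`. -/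
structure FirstMoved (N : ℕ) (g : Equiv.Perm ℕ) (i e : ℕ) : Prop where
  aut : IsAut N g
  fix : ∀ j < i, g j = j
  le : i ≤ N
  lo : Nat.fib (e + 3) ≤ i
  hi : i < Nat.fib (e + 4)
  ne : g i ≠ i

namespace FirstMoved

variable {N : ℕ} {g : Equiv.Perm ℕ} {i e : ℕ}

theorem lt_map (H : FirstMoved N g i e) : i < g i := by
  by_contra h
  have hlt : g i < i := lt_of_le_of_ne (not_lt.1 h) H.ne
  exact H.ne (g.injective (H.fix _ hlt))

theorem one_le (H : FirstMoved N g i e) : 1 ≤ i :=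
  le_trans (Nat.fib_pos.2 (by omega)) H.lo

theorem map_le (H : FirstMoved N g i e) : g i ≤ N :=
  (H.aut.mem H.one_le H.le).2

/-- Adjacency of a moved vertex to a fixed one is inherited by its image. -/
theorem adj_fixed (H : FirstMoved N g i e) {b : ℕ} (hb : b < i) (h : SumAdj N i b) :
    SumAdj N (g i) b := by
  have := (H.aut.1 i b).1 h
  rwa [H.fix b hb] at this

theorem adj_low (H : FirstMoved N g i e) : SumAdj N i (Nat.fib (e + 4) - i) := by
  have e4 : Nat.fib (e + 4) = Nat.fib (e + 2) + Nat.fib (e + 3) := Nat.fib_add_two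
  have h1 := fib_lt_of_lt (show 2 ≤ e + 2 by omega) (show e + 2 < e + 3 by omega)
  have := H.lo
  have := H.hi
  have := H.le
  exact ⟨by omega, by omega, by omega, by omega, by omega, e + 4, by omega⟩

/-- The fixed vertex `F_{e+4} - i` is adjacent to `g i` as well, and `g i > i` makes the new sum a
larger Fibonacci number. The shift `d` also locates the block of `g i`. -/
theorem map_add (H : FirstMoved N g i e) :
    ∃ d, g i + Nat.fib (e + 4) = Nat.fib (e + 5 + d) + i := by
  have e4 : Nat.fib (e + 4) = Nat.fib (e + 2) + Nat.fib (e + 3) := Nat.fib_add_two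
  have h1 := fib_lt_of_lt (show 2 ≤ e + 2 by omega) (show e + 2 < e + 3 by omega)
  have := H.lo
  have := H.hi
  have hlt := H.lt_map
  obtain ⟨_, _, _, _, _, l, hl⟩ := H.adj_fixed (by omega) H.adj_low
  have : e + 4 < l := lt_of_fib_lt (by omega)
  refine ⟨l - (e + 5), ?_⟩
  rw [show e + 5 + (l - (e + 5)) = l by omega]
  omega

theorem map_bracket (H : FirstMoved N g i e) {d : ℕ}
    (hd : g i + Nat.fib (e + 4) = Nat.fib (e + 5 + d) + i) :
    Nat.fib (e + 4 + d) ≤ g i ∧ g i < Nat.fib (e + 4 + d + 1) := by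
  have e4 : Nat.fib (e + 4) = Nat.fib (e + 2) + Nat.fib (e + 3) := Nat.fib_add_two
  have e5 : Nat.fib (e + 3 + d + 2) = Nat.fib (e + 3 + d) + Nat.fib (e + 3 + d + 1) :=
    Nat.fib_add_two
  rw [show e + 3 + d + 2 = e + 5 + d by omega, show e + 3 + d + 1 = e + 4 + d by omega] at e5
  rw [show e + 4 + d + 1 = e + 5 + d by omega]
  have h1 := Nat.fib_mono (show e + 2 ≤ e + 3 + d by omega)
  have := H.lo
  have := H.hi
  omega

/-- This excludes `d = 0`, that is `g i = F_{e+3} + i`. If `F_{e+4} + a` is a vertex other than `g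
i`, it is adjacent to `g i` and to a fixed vertex `c`, which determines its preimage; otherwise
degrees decide. -/
theorem map_add_ne (H : FirstMoved N g i e) :
    g i + Nat.fib (e + 4) ≠ Nat.fib (e + 5) + i := by
  intro hd
  have e3 : Nat.fib (e + 3) = Nat.fib (e + 1) + Nat.fib (e + 2) := Nat.fib_add_two
  have e4 : Nat.fib (e + 4) = Nat.fib (e + 2) + Nat.fib (e + 3) := Nat.fib_add_two
  have e5 : Nat.fib (e + 5) = Nat.fib (e + 3) + Nat.fib (e + 4) := Nat.fib_add_two
  have e6 : Nat.fib (e + 6) = Nat.fib (e + 4) + Nat.fib (e + 5) := Nat.fib_add_two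
  have h1 := Nat.fib_pos.2 (show 0 < e + 1 by omega)
  have hlo := H.lo
  have hhi := H.hi
  have hle := H.le
  have hgl := H.map_le
  obtain ⟨hb, hb'⟩ := H.map_bracket (d := 0) hd
  simp only [add_zero, add_assoc, Nat.reduceAdd] at hb hb'
  obtain ⟨a, ha⟩ : ∃ a, a + i = Nat.fib (e + 4) := ⟨Nat.fib (e + 4) - i, by omega⟩
  have ga : g a = a := H.fix a (by omega)
  by_cases hy : Nat.fib (e + 4) + a ≤ N ∧ Nat.fib (e + 4) + a ≠ g i
  · obtain ⟨c, hc⟩ : ∃ c, c + a = Nat.fib (e + 3) := ⟨Nat.fib (e + 3) - a, by omega⟩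
    have gc : g c = c := H.fix c (by omega)
    have adj1 : SumAdj N (g i) (Nat.fib (e + 4) + a) :=
      ⟨by omega, by omega, by omega, by omega, by omega, e + 6, by omega⟩
    have adj2 : SumAdj N (g c) (Nat.fib (e + 4) + a) :=
      ⟨by omega, by omega, by omega, by omega, by omega, e + 5, by omega⟩
    obtain ⟨x, hx, _, _, hx1, _, _, s, hs⟩ := H.aut.exists_preimage adj1
    obtain ⟨x', hx', _, _, _, _, _, t, ht⟩ := H.aut.exists_preimage adj2
    obtain rfl : x = x' := g.injective (by omega)
    -- Since `i - c = F_{e+2}`, subtracting the two sums gives `F_s = F_t + F_{e+2}`, which forces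
    -- `s = e + 4` and `x = a`, a fixed vertex.
    have h2 : e + 3 < s := lt_of_fib_lt (by omega)
    have hts : t < s := lt_of_fib_lt (by omega)
    obtain ⟨r, rfl⟩ : ∃ r, s = r + 2 := ⟨s - 2, by omega⟩
    have h3 := fib_add_fib_le hts
    have h4 : r < e + 3 := lt_of_fib_lt (by omega)
    obtain rfl : r = e + 2 := by omega
    have h5 : x = a := by
      rw [show e + 2 + 2 = e + 4 by omega] at hs
      omega
    rw [h5, ga] at hx
    omega
  · obtain ⟨m, _, hm, hm'⟩ := exists_fib_bracket (v := N) (by omega)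
    obtain ⟨K, hK, hK', hc⟩ := exists_top_index hm hm' hle
    obtain ⟨L, hL, hL', hc'⟩ := exists_top_index hm hm' hgl
    have hdeg := H.aut.sumDeg_eq i
    have hpos := sumDeg_ne_zero H.adj_low
    have D1 := sumDeg_cases hle (by omega) hlo hhi hK hK'
    have D2 := sumDeg_cases hgl (show 3 ≤ e + 4 by omega) hb hb' hL hL'
    simp only [add_assoc, Nat.reduceAdd] at D1 D2
    by_cases hyN : Nat.fib (e + 4) + a ≤ N
    · have hhalf : Nat.fib (e + 6) = 2 * g i := by omega
      have d1 := three_dvd_of_fib_even hhalf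
      have d2 : Nat.fib (e + 5) ≠ 2 * i := fun h => by
        have := three_dvd_of_fib_even h
        omega
      have hKL : L = K + 2 := by omega
      have e2m : Nat.fib (m + 2) = Nat.fib m + Nat.fib (m + 1) := Nat.fib_add_two
      have h2 : m < e + 5 := lt_of_fib_lt (by omega)
      have h3 : m = e + 4 := by omega
      subst h3
      simp only [add_assoc, Nat.reduceAdd] at *
      omega
    -- As `F_{e+4} + a` and `g i` add up to `F_{e+6}`, having the former above `N` leaves too few
    -- possible sums.
    · have hL5 : L < e + 6 := lt_of_fib_lt (by omega)
      have hK4 : K < L + 1 := lt_of_fib_lt (by omega)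
      have hKv : K = e + 4 ∨ K = e + 5 := by omega
      rcases hKv with rfl | rfl
      · simp only [add_assoc, Nat.reduceAdd] at *
        omega
      · omega

/-- The degree of the first moved vertex is preserved only if it is half a Fibonacci number. -/
theorem half_and_degree (H : FirstMoved N g i e) {d m : ℕ}
    (hd : g i + Nat.fib (e + 4) = Nat.fib (e + 5 + d) + i) (hd1 : 1 ≤ d)
    (hm : Nat.fib m ≤ N) (hm' : N < Nat.fib (m + 1)) :
    Nat.fib (e + 5) = 2 * i ∧
      ∃ K, sumDeg N (g i) = K + d - (e + 4 + d) ∧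
        (K = m ∧ i + N < Nat.fib (m + 1) ∨ K = m + 1 ∧ Nat.fib (m + 1) ≤ i + N) ∧
        (K + d = m + 1 ∧ Nat.fib (m + 1) ≤ g i + N ∧ g i + N < Nat.fib (m + 2) ∨
          K + d = m + 2 ∧ Nat.fib (m + 2) ≤ g i + N) := by
  have hlo := H.lo
  have hhi := H.hi
  have hle := H.le
  have hgl := H.map_le
  obtain ⟨hb, hb'⟩ := H.map_bracket hd
  obtain ⟨K, hK, hK', hc⟩ := exists_top_index hm hm' hle
  obtain ⟨L, hL, hL', hc'⟩ := exists_top_index hm hm' hgl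
  have hdeg := H.aut.sumDeg_eq i
  have hpos := sumDeg_ne_zero H.adj_low
  have D1 := sumDeg_cases hle (by omega) hlo hhi hK hK'
  have D2 := sumDeg_cases hgl (show 3 ≤ e + 4 + d by omega) hb hb' hL hL'
  have e2m : Nat.fib (m + 2) = Nat.fib m + Nat.fib (m + 1) := Nat.fib_add_two
  rcases D1 with ⟨h, D1⟩ | ⟨h, D1⟩
  · simp only [add_assoc, Nat.reduceAdd] at h
    -- With `2i = F_{e+5}` one gets `2 g i = 2 F_{e+5+d} - F_{e+2}`, while `F_{e+6+d} = 2 F_{e+5+d}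
    -- - F_{e+3+d}`.
    have h' : Nat.fib (e + 4 + d + 2) ≠ 2 * g i := by
      intro h'
      have e4 : Nat.fib (e + 4) = Nat.fib (e + 2) + Nat.fib (e + 3) := Nat.fib_add_two
      have e5 : Nat.fib (e + 5) = Nat.fib (e + 3) + Nat.fib (e + 4) := Nat.fib_add_two
      have e5d : Nat.fib (e + 3 + d + 2) = Nat.fib (e + 3 + d) + Nat.fib (e + 3 + d + 1) :=
        Nat.fib_add_two
      have e6d : Nat.fib (e + 4 + d + 2) = Nat.fib (e + 4 + d) + Nat.fib (e + 4 + d + 1) :=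
        Nat.fib_add_two
      rw [show e + 3 + d + 2 = e + 5 + d by omega, show e + 3 + d + 1 = e + 4 + d by omega] at e5d
      rw [show e + 4 + d + 1 = e + 5 + d by omega] at e6d
      have := fib_lt_of_lt (show 2 ≤ e + 2 by omega) (show e + 2 < e + 3 + d by omega)
      omega
    have D2' : sumDeg N (g i) = L - (e + 4 + d) := by tauto
    have hKL : L = K + d := by omega
    subst hKL
    refine ⟨h, K, D2', by omega, by omega⟩
  · exfalso
    have hKL : L = K + 2 ∧ d = 1 := by omega
    obtain ⟨rfl, rfl⟩ := hKL
    have h1 : m < e + 4 + 1 + 1 := lt_of_fib_lt (by omega)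
    have h2 : e + 4 + 1 < m + 1 := lt_of_fib_lt (by omega)
    obtain rfl : m = e + 5 := by omega
    have e6 : Nat.fib (e + 6) = Nat.fib (e + 4) + Nat.fib (e + 5) := Nat.fib_add_two
    simp only [add_assoc, Nat.reduceAdd] at *
    omega

-- This excludes `d = 2`. Starting from `i`, three successive neighbours are pulled back through
-- `g`, with the fixed vertices `a` and `c` limiting the last two; the third preimage turns out to
-- be `a`, which is fixed.
set_option maxHeartbeats 1000000 in
theorem map_add_two_ne (H : FirstMoved N g i e) (hh : Nat.fib (e + 5) = 2 * i)
    (hN : i + N < Nat.fib (e + 7)) (hN' : Nat.fib (e + 8) ≤ g i + N) :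
    g i + Nat.fib (e + 4) ≠ Nat.fib (e + 7) + i := by
  intro hd
  have e3 : Nat.fib (e + 3) = Nat.fib (e + 1) + Nat.fib (e + 2) := Nat.fib_add_two
  have e4 : Nat.fib (e + 4) = Nat.fib (e + 2) + Nat.fib (e + 3) := Nat.fib_add_two
  have e5 : Nat.fib (e + 5) = Nat.fib (e + 3) + Nat.fib (e + 4) := Nat.fib_add_two
  have e6 : Nat.fib (e + 6) = Nat.fib (e + 4) + Nat.fib (e + 5) := Nat.fib_add_two
  have e7 : Nat.fib (e + 7) = Nat.fib (e + 5) + Nat.fib (e + 6) := Nat.fib_add_two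
  have e8 : Nat.fib (e + 8) = Nat.fib (e + 6) + Nat.fib (e + 7) := Nat.fib_add_two
  have h1 := Nat.fib_pos.2 (show 0 < e + 1 by omega)
  have h1' := Nat.fib_pos.2 (show 0 < e + 2 by omega)
  have hlo := H.lo
  have hhi := H.hi
  have hle := H.le
  have hgl := H.map_le
  obtain ⟨a, ha⟩ : ∃ a, a + i = Nat.fib (e + 4) := ⟨Nat.fib (e + 4) - i, by omega⟩
  obtain ⟨c, hc⟩ : ∃ c, c + a = Nat.fib (e + 3) := ⟨Nat.fib (e + 3) - a, by omega⟩
  have ga : g a = a := H.fix a (by omega)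
  have gc : g c = c := H.fix c (by omega)
  have adj1 : SumAdj N (g i) (Nat.fib (e + 6) + a) :=
    ⟨by omega, by omega, by omega, by omega, by omega, e + 8, by omega⟩
  obtain ⟨y, hy, -, -, hy1, -, hyi, s, hs⟩ := H.aut.exists_preimage adj1
  have hsy : y + i = Nat.fib (e + 6) := by
    have hs1 : e + 3 < s := lt_of_fib_lt (by omega)
    have hs2 : s < e + 7 := lt_of_fib_lt (by omega)
    obtain rfl | rfl | rfl : s = e + 4 ∨ s = e + 5 ∨ s = e + 6 := by omega
    · obtain rfl : y = a := by omega
      omega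
    · omega
    · omega
  clear hs hyi
  have adj2 : SumAdj N (g y) (Nat.fib (e + 5) - a) :=
    ⟨by omega, by omega, by omega, by omega, by omega, e + 7, by omega⟩
  obtain ⟨z, hz, -, -, hz1, -, -, u, hu⟩ := H.aut.exists_preimage adj2
  have adj3 : SumAdj N (g a) (g z) :=
    ⟨by omega, by omega, by omega, by omega, by omega, e + 5, by omega⟩
  obtain ⟨-, -, -, -, -, t, ht⟩ := (H.aut.1 a z).2 adj3
  -- Since `y - a = F_{e+5}`, the sums satisfy `F_u = F_{e+5} + F_t`; the solution `F_t = F_{e+4}`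
  -- would give `z = i`.
  have hz' : z + a = Nat.fib (e + 6) := by
    rcases fib_eq_fib_add (c := e + 3) (t := t) (u := u) (by omega)
      (by simp only [add_assoc, Nat.reduceAdd]; omega) with h | h
    · simp only [add_assoc, Nat.reduceAdd] at h
      obtain rfl : z = i := by omega
      omega
    · simp only [add_assoc, Nat.reduceAdd] at h
      omega
  clear hu ht
  have adj4 : SumAdj N (g z) (Nat.fib (e + 4) + a) :=
    ⟨by omega, by omega, by omega, by omega, by omega, e + 6, by omega⟩
  obtain ⟨w, hw, -, -, hw1, -, -, p, hp⟩ := H.aut.exists_preimage adj4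
  have adj5 : SumAdj N (g c) (g w) :=
    ⟨by omega, by omega, by omega, by omega, by omega, e + 5, by omega⟩
  obtain ⟨-, -, -, -, -, q, hq⟩ := (H.aut.1 c w).2 adj5
  -- Here `z - c = F_{e+6} - F_{e+3} = 2 F_{e+4}`, whence `F_p = F_q + 2 F_{e+4}`.
  have hp1 : e + 5 < p := lt_of_fib_lt (by omega)
  have hpe := fib_eq_add_two_mul_fib (c := e + 2) (p := p) (q := q) (by omega) (by omega)
    (by simp only [add_assoc, Nat.reduceAdd]; omega)
  simp only [add_assoc, Nat.reduceAdd] at hpe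
  subst hpe
  obtain rfl : w = a := by omega
  omega

set_option maxHeartbeats 1000000 in
/-- The first moved vertex cannot be sent to its triple when `N` is large. -/
theorem sumDeg_map_ne (H : FirstMoved N g i e) (hh : Nat.fib (e + 5) = 2 * i)
    (hd : g i + Nat.fib (e + 4) = Nat.fib (e + 6) + i) (hN : Nat.fib (e + 8) ≤ N) {m : ℕ}
    (hm : Nat.fib m ≤ N) (hm' : N < Nat.fib (m + 1)) : sumDeg N (g i) ≠ m - (e + 4) := by
  intro hdeg
  have e3 : Nat.fib (e + 3) = Nat.fib (e + 1) + Nat.fib (e + 2) := Nat.fib_add_two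
  have e4 : Nat.fib (e + 4) = Nat.fib (e + 2) + Nat.fib (e + 3) := Nat.fib_add_two
  have e5 : Nat.fib (e + 5) = Nat.fib (e + 3) + Nat.fib (e + 4) := Nat.fib_add_two
  have e6 : Nat.fib (e + 6) = Nat.fib (e + 4) + Nat.fib (e + 5) := Nat.fib_add_two
  have e7 : Nat.fib (e + 7) = Nat.fib (e + 5) + Nat.fib (e + 6) := Nat.fib_add_two
  have e8 : Nat.fib (e + 8) = Nat.fib (e + 6) + Nat.fib (e + 7) := Nat.fib_add_two
  have e9 : Nat.fib (e + 9) = Nat.fib (e + 7) + Nat.fib (e + 8) := Nat.fib_add_two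
  have h1 := Nat.fib_pos.2 (show 0 < e + 1 by omega)
  have h1' := Nat.fib_pos.2 (show 0 < e + 2 by omega)
  have hlo := H.lo
  have hhi := H.hi
  have hle := H.le
  have hgl := H.map_le
  obtain ⟨a, ha⟩ : ∃ a, a + i = Nat.fib (e + 4) := ⟨Nat.fib (e + 4) - i, by omega⟩
  have ga : g a = a := H.fix a (by omega)
  obtain ⟨u, hu⟩ : ∃ u, u + g i = Nat.fib (e + 8) := ⟨Nat.fib (e + 8) - g i, by omega⟩
  obtain ⟨w, hw⟩ : ∃ w, w + a = Nat.fib (e + 8) := ⟨Nat.fib (e + 8) - a, by omega⟩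
  have adj1 : SumAdj N (g i) u :=
    ⟨by omega, by omega, by omega, by omega, by omega, e + 8, by omega⟩
  obtain ⟨x, hx, -, -, hx1, -, hxi, s, hs⟩ := H.aut.exists_preimage adj1
  have hs5 : e + 5 < s := by
    have hs1 : e + 3 < s := lt_of_fib_lt (by omega)
    by_contra hc
    obtain rfl | rfl : s = e + 4 ∨ s = e + 5 := by omega
    · obtain rfl : x = a := by omega
      omega
    · omega
  clear hxi
  have adj2 : SumAdj N (g x) w :=
    ⟨by omega, by omega, by omega, by omega, by omega, e + 9, by omega⟩
  obtain ⟨y, hy, -, -, hy1, -, -, r, hr⟩ := H.aut.exists_preimage adj2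
  have adj3 : SumAdj N (g a) (g y) :=
    ⟨by omega, by omega, by omega, by omega, by omega, e + 8, by omega⟩
  obtain ⟨-, -, -, -, -, t, ht⟩ := (H.aut.1 a y).2 adj3
  have ht4 : t ≠ e + 4 := by
    rintro rfl
    obtain rfl : y = i := by omega
    omega
  -- The 4-cycle `i, x, y, a` gives `(x + i) + (a + y) = (x + y) + (a + i)`, where `a + i =
  -- F_{e+4}`. Hence `y = F_{e+6} - a = g i`.
  have key := fib_add_fib_eq (by omega) hs5
    (by rw [ht]; exact Nat.add_pos_right a hy1) ht4
    (show Nat.fib s + Nat.fib t = Nat.fib r + _ by rw [hs, ht, hr, ← ha]; ring)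
  simp only [add_assoc, Nat.reduceAdd] at key
  subst key
  have hyg : y = g i := by omega
  have hdy := H.aut.sumDeg_eq y
  rw [hy, hyg] at hdy
  have hwN : w ≤ N := by omega
  -- Now `w = g (g i)` must have the degree of `g i`, but it lies in block `e + 7`, so its degree is
  -- at most `m + 2 - (e + 7)`.
  obtain ⟨K, hK, hK', hc⟩ := exists_top_index hm hm' hwN
  have hwd := sumDeg_le (k := e + 7) hwN (by omega) (by omega)
    (by rw [show e + 7 + 1 = e + 8 by omega]; omega) hK hK'
  have : e + 8 < m + 1 := lt_of_fib_lt (by omega)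
  omega

end FirstMoved

/-! ### The ranges of `N` that allow a non-trivial automorphism. -/

/-- The values of `N` for which `G_N` has an automorphism exchanging `F_n / 2` and `3 F_n / 2`. -/
def SwapRange (n N : ℕ) : Prop :=
  3 * (Nat.fib n / 2) ≤ N ∧ N < Nat.fib (n + 3) / 2 ∨
    Nat.fib (n + 2) + Nat.fib (n - 3) / 2 ≤ N ∧ N < Nat.fib (n + 3) - Nat.fib n / 2

theorem FirstMoved.exists_swapRange {N : ℕ} {g : Equiv.Perm ℕ} {i e : ℕ}
    (H : FirstMoved N g i e) :
    ∃ n, 6 ≤ n ∧ 3 ∣ n ∧ i = Nat.fib n / 2 ∧ g i = 3 * (Nat.fib n / 2) ∧ SwapRange n N := by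
  have hlo := H.lo
  have hhi := H.hi
  have hle := H.le
  have hgl := H.map_le
  have e3 : Nat.fib (e + 3) = Nat.fib (e + 1) + Nat.fib (e + 2) := Nat.fib_add_two
  have e4 : Nat.fib (e + 4) = Nat.fib (e + 2) + Nat.fib (e + 3) := Nat.fib_add_two
  have e5 : Nat.fib (e + 5) = Nat.fib (e + 3) + Nat.fib (e + 4) := Nat.fib_add_two
  have e6 : Nat.fib (e + 6) = Nat.fib (e + 4) + Nat.fib (e + 5) := Nat.fib_add_two
  have e7 : Nat.fib (e + 7) = Nat.fib (e + 5) + Nat.fib (e + 6) := Nat.fib_add_two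
  have e8 : Nat.fib (e + 8) = Nat.fib (e + 6) + Nat.fib (e + 7) := Nat.fib_add_two
  obtain ⟨m, _, hm, hm'⟩ := exists_fib_bracket (v := N) (le_trans H.one_le hle)
  obtain ⟨d, hd⟩ := H.map_add
  have hd0 : d ≠ 0 := by
    rintro rfl
    exact H.map_add_ne hd
  obtain ⟨hb, hb'⟩ := H.map_bracket hd
  obtain ⟨hh, K, hdeg, hK, hL⟩ := H.half_and_degree hd (by omega) hm hm'
  have e2m : Nat.fib (m + 2) = Nat.fib m + Nat.fib (m + 1) := Nat.fib_add_two
  have hdvd := three_dvd_of_fib_even hh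
  have hd12 : d = 1 ∨ d = 2 := by omega
  rcases hd12 with rfl | rfl
  · simp only [add_assoc, Nat.reduceAdd] at hb hb' hd
    refine ⟨e + 5, by omega, hdvd, by omega, by omega, ?_⟩
    unfold SwapRange
    rw [show e + 5 - 3 = e + 2 by omega]
    simp only [add_assoc, Nat.reduceAdd]
    by_contra hc
    -- The first range ends here, because `F_{e+8} = 2 F_{e+6} + F_{e+5}` gives `F_{e+8} / 2 =
    -- F_{e+6} + i`.
    have hN8 : Nat.fib (e + 6) + i ≤ N := by omega
    have hm6 : e + 6 < m + 1 := lt_of_fib_lt (by omega)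
    have hm6' := Nat.fib_mono (show e + 6 ≤ m by omega)
    have hKm : K = m := by omega
    subst hKm
    have hK6 : K ≠ e + 6 := by
      rintro rfl
      simp only [add_assoc, Nat.reduceAdd] at *
      omega
    -- For `m = e + 7` the conditions `i + N < F_{e+8} ≤ g i + N` are precisely the second range.
    -- Larger `m` is left to `sumDeg_map_ne`.
    have hK7 : K ≠ e + 7 := by
      rintro rfl
      simp only [add_assoc, Nat.reduceAdd] at *
      omega
    have hN : Nat.fib (e + 8) ≤ N := le_trans (Nat.fib_mono (by omega)) hm
    exact H.sumDeg_map_ne hh hd hN hm hm' (by omega)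
  · exfalso
    simp only [add_assoc, Nat.reduceAdd] at hb hb' hd
    have h1 : m < e + 7 := lt_of_fib_lt (by omega)
    have h2 : e + 6 < m + 1 := lt_of_fib_lt (by omega)
    obtain rfl : m = e + 6 := by omega
    simp only [add_assoc, Nat.reduceAdd] at *
    exact H.map_add_two_ne hh (by omega) (by omega) hd

/-! ### Existence of the involutions. -/

theorem isAut_of_involutive {N : ℕ} {g : Equiv.Perm ℕ} (hinv : ∀ u, g (g u) = u)
    (hadj : ∀ u v, SumAdj N u v → SumAdj N (g u) (g v))
    (hout : ∀ u, ¬(1 ≤ u ∧ u ≤ N) → g u = u) : IsAut N g := by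
  refine ⟨fun u v => ⟨hadj u v, fun h => ?_⟩, hout⟩
  have := hadj _ _ h
  rwa [hinv, hinv] at this

/-- To check that `g` preserves edges it suffices to look at edges with a moved end. -/
theorem adj_map_of_moved {N : ℕ} {g : Equiv.Perm ℕ}
    (h : ∀ u v, g u ≠ u → SumAdj N u v → SumAdj N (g u) (g v)) (u v : ℕ) (huv : SumAdj N u v) :
    SumAdj N (g u) (g v) := by
  by_cases hu : g u = u
  · by_cases hv : g v = v
    · rwa [hu, hv]
    · exact (h v u hv huv.symm).symm
  · exact h u v hu huv

/-- The vertices `i` and `3i` have the same neighbours: `F_{e+4} - i = F_{e+6} - 3i` and `F_{e+6} -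
i = F_{e+7} - 3i`. The upper bound on `N` keeps out `F_{e+7} - i = F_{e+6} + i`, the next neighbour
of `i`. -/
theorem isAut_swap {N e i : ℕ} (hh : Nat.fib (e + 5) = 2 * i) (h1 : 3 * i ≤ N)
    (h2 : N < Nat.fib (e + 6) + i) : IsAut N (Equiv.swap i (3 * i)) := by
  have e3 : Nat.fib (e + 3) = Nat.fib (e + 1) + Nat.fib (e + 2) := Nat.fib_add_two
  have e4 : Nat.fib (e + 4) = Nat.fib (e + 2) + Nat.fib (e + 3) := Nat.fib_add_two
  have e5 : Nat.fib (e + 5) = Nat.fib (e + 3) + Nat.fib (e + 4) := Nat.fib_add_two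
  have e6 : Nat.fib (e + 6) = Nat.fib (e + 4) + Nat.fib (e + 5) := Nat.fib_add_two
  have e7 : Nat.fib (e + 7) = Nat.fib (e + 5) + Nat.fib (e + 6) := Nat.fib_add_two
  have e8 : Nat.fib (e + 8) = Nat.fib (e + 6) + Nat.fib (e + 7) := Nat.fib_add_two
  have p1 := Nat.fib_pos.2 (show 0 < e + 1 by omega)
  have p2 := Nat.fib_pos.2 (show 0 < e + 2 by omega)
  have fixes : ∀ v, v ≠ i → v ≠ 3 * i → Equiv.swap i (3 * i) v = v := fun v h h' =>
    Equiv.swap_apply_of_ne_of_ne h h'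
  refine isAut_of_involutive (fun u => Equiv.swap_apply_self _ _ u) (adj_map_of_moved ?_)
    fun u hu => fixes u (by omega) (by omega)
  intro u v hu ⟨_, _, hv1, hvN, huv, s, hs⟩
  by_cases hui : u = i
  · subst hui
    have s1 : e + 3 < s := lt_of_fib_lt (by omega)
    have s2 : s < e + 7 := lt_of_fib_lt (by omega)
    have s3 : s ≠ e + 5 := fun h => by rw [h] at hs; omega
    have s4 : s = e + 4 ∨ s = e + 6 := by omega
    rcases s4 with rfl | rfl <;> rw [Equiv.swap_apply_left, fixes v (by omega) (by omega)]
    · exact ⟨by omega, by omega, by omega, by omega, by omega, e + 6, by omega⟩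
    · exact ⟨by omega, by omega, by omega, by omega, by omega, e + 7, by omega⟩
  by_cases hui' : u = 3 * i
  · subst hui'
    have s1 : e + 5 < s := lt_of_fib_lt (by omega)
    have s2 : s < e + 8 := lt_of_fib_lt (by omega)
    have s4 : s = e + 6 ∨ s = e + 7 := by omega
    rcases s4 with rfl | rfl <;> rw [Equiv.swap_apply_right, fixes v (by omega) (by omega)]
    · exact ⟨by omega, by omega, by omega, by omega, by omega, e + 4, by omega⟩
    · exact ⟨by omega, by omega, by omega, by omega, by omega, e + 6, by omega⟩
  · exact absurd (fixes u hui hui') hu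

-- Besides their common neighbours, `i` has the pendant neighbour `q` (`i + q = F_{e+7}`) and `3i`
-- has the pendant neighbour `p` (`3i + p = F_{e+8}`), so exchanging both pairs restores the
-- symmetry. It lasts until `F_{e+8} - i` becomes a vertex.
set_option maxHeartbeats 1000000 in
theorem isAut_double_swap {N e i p q : ℕ} (hh : Nat.fib (e + 5) = 2 * i)
    (hp : p + 3 * i = Nat.fib (e + 8)) (hq : 2 * q = Nat.fib (e + 8))
    (h1 : p ≤ N) (h2 : N + i < Nat.fib (e + 8)) :
    IsAut N (Equiv.swap i (3 * i) * Equiv.swap p q) := by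
  have e3 : Nat.fib (e + 3) = Nat.fib (e + 1) + Nat.fib (e + 2) := Nat.fib_add_two
  have e4 : Nat.fib (e + 4) = Nat.fib (e + 2) + Nat.fib (e + 3) := Nat.fib_add_two
  have e5 : Nat.fib (e + 5) = Nat.fib (e + 3) + Nat.fib (e + 4) := Nat.fib_add_two
  have e6 : Nat.fib (e + 6) = Nat.fib (e + 4) + Nat.fib (e + 5) := Nat.fib_add_two
  have e7 : Nat.fib (e + 7) = Nat.fib (e + 5) + Nat.fib (e + 6) := Nat.fib_add_two
  have e8 : Nat.fib (e + 8) = Nat.fib (e + 6) + Nat.fib (e + 7) := Nat.fib_add_two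
  have e9 : Nat.fib (e + 9) = Nat.fib (e + 7) + Nat.fib (e + 8) := Nat.fib_add_two
  have e10 : Nat.fib (e + 10) = Nat.fib (e + 8) + Nat.fib (e + 9) := Nat.fib_add_two
  have p1 := Nat.fib_pos.2 (show 0 < e + 1 by omega)
  have p2 := Nat.fib_pos.2 (show 0 < e + 2 by omega)
  set g : Equiv.Perm ℕ := Equiv.swap i (3 * i) * Equiv.swap p q with hg
  have fixes : ∀ v, v ≠ i → v ≠ 3 * i → v ≠ p → v ≠ q → g v = v := fun v a b c d => by
    rw [hg, Equiv.Perm.mul_apply, Equiv.swap_apply_of_ne_of_ne c d,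
      Equiv.swap_apply_of_ne_of_ne a b]
  have gi : g i = 3 * i := by
    rw [hg, Equiv.Perm.mul_apply,
      Equiv.swap_apply_of_ne_of_ne (a := p) (b := q) (by omega) (by omega),
      Equiv.swap_apply_left]
  have gi' : g (3 * i) = i := by
    rw [hg, Equiv.Perm.mul_apply,
      Equiv.swap_apply_of_ne_of_ne (a := p) (b := q) (by omega) (by omega),
      Equiv.swap_apply_right]
  have gp : g p = q := by
    rw [hg, Equiv.Perm.mul_apply, Equiv.swap_apply_left,
      Equiv.swap_apply_of_ne_of_ne (by omega) (by omega)]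
  have gq : g q = p := by
    rw [hg, Equiv.Perm.mul_apply, Equiv.swap_apply_right,
      Equiv.swap_apply_of_ne_of_ne (by omega) (by omega)]
  clear_value g
  have cases4 : ∀ u, u = i ∨ u = 3 * i ∨ u = p ∨ u = q ∨ g u = u := by
    intro u
    by_cases a : u = i
    · exact Or.inl a
    by_cases b : u = 3 * i
    · exact Or.inr (Or.inl b)
    by_cases c : u = p
    · exact Or.inr (Or.inr (Or.inl c))
    by_cases d : u = q
    · exact Or.inr (Or.inr (Or.inr (Or.inl d)))
    exact Or.inr (Or.inr (Or.inr (Or.inr (fixes u a b c d))))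
  refine isAut_of_involutive (fun u => ?_) (adj_map_of_moved ?_)
    fun u hu => fixes u (by omega) (by omega) (by omega) (by omega)
  · rcases cases4 u with rfl | rfl | rfl | rfl | h
    · rw [gi, gi']
    · rw [gi', gi]
    · rw [gp, gq]
    · rw [gq, gp]
    · rw [h, h]
  intro u v hu ⟨_, _, hv1, hvN, huv, s, hs⟩
  rcases cases4 u with rfl | rfl | rfl | rfl | h
  · have s1 : e + 3 < s := lt_of_fib_lt (by omega)
    have s2 : s < e + 8 := lt_of_fib_lt (by omega)
    have s3 : s ≠ e + 5 := fun h => by rw [h] at hs; omega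
    have s4 : s = e + 4 ∨ s = e + 6 ∨ s = e + 7 := by omega
    rw [gi]
    rcases s4 with rfl | rfl | rfl
    · rw [fixes v (by omega) (by omega) (by omega) (by omega)]
      exact ⟨by omega, by omega, by omega, by omega, by omega, e + 6, by omega⟩
    · rw [fixes v (by omega) (by omega) (by omega) (by omega)]
      exact ⟨by omega, by omega, by omega, by omega, by omega, e + 7, by omega⟩
    · obtain rfl : v = q := by omega
      rw [gq]
      exact ⟨by omega, by omega, by omega, by omega, by omega, e + 8, by omega⟩
  · have s1 : e + 5 < s := lt_of_fib_lt (by omega)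
    have s2 : s < e + 9 := lt_of_fib_lt (by omega)
    have s4 : s = e + 6 ∨ s = e + 7 ∨ s = e + 8 := by omega
    rw [gi']
    rcases s4 with rfl | rfl | rfl
    · rw [fixes v (by omega) (by omega) (by omega) (by omega)]
      exact ⟨by omega, by omega, by omega, by omega, by omega, e + 4, by omega⟩
    · rw [fixes v (by omega) (by omega) (by omega) (by omega)]
      exact ⟨by omega, by omega, by omega, by omega, by omega, e + 6, by omega⟩
    · obtain rfl : v = p := by omega
      rw [gp]
      exact ⟨by omega, by omega, by omega, by omega, by omega, e + 7, by omega⟩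
  · have s1 : e + 7 < s := lt_of_fib_lt (by omega)
    have s2 : s < e + 9 := lt_of_fib_lt (by omega)
    obtain rfl : s = e + 8 := by omega
    obtain rfl : v = 3 * i := by omega
    rw [gp, gi']
    exact ⟨by omega, by omega, by omega, by omega, by omega, e + 7, by omega⟩
  · have s1 : e + 6 < s := lt_of_fib_lt (by omega)
    have s2 : s < e + 9 := lt_of_fib_lt (by omega)
    have s3 : s ≠ e + 8 := fun h => by rw [h] at hs; omega
    obtain rfl : s = e + 7 := by omega
    obtain rfl : v = i := by omega
    rw [gq, gi]
    exact ⟨by omega, by omega, by omega, by omega, by omega, e + 8, by omega⟩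
  · exact absurd h hu

/-! ### Uniqueness of the non-trivial automorphism. -/

theorem IsAut.exists_of_ne_one {N : ℕ} {g : Equiv.Perm ℕ} (hN : 34 ≤ N) (hg : IsAut N g)
    (hne : g ≠ 1) : ∃ n, 6 ≤ n ∧ 3 ∣ n ∧ g (Nat.fib n / 2) = 3 * (Nat.fib n / 2) ∧
      SwapRange n N := by
  have hex : ∃ i, g i ≠ i := by
    by_contra h
    push Not at h
    exact hne (Equiv.ext h)
  classical
  obtain ⟨i, hi, hmin⟩ : ∃ i, g i ≠ i ∧ ∀ j < i, g j = j :=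
    ⟨Nat.find hex, Nat.find_spec hex, fun j hj => not_not.1 (Nat.find_min hex hj)⟩
  have hmem : 1 ≤ i ∧ i ≤ N := by
    by_contra h
    exact hi (hg.2 i h)
  -- Blocks are indexed from `F_3 = 2`, so the vertex `1` is covered separately.
  have hi1 : i ≠ 1 := fun h => hi (h ▸ hg.map_one hN)
  obtain ⟨k, hk2, hk, hk'⟩ := exists_fib_bracket hmem.1
  have hk3 : k ≠ 2 := by
    rintro rfl
    have : Nat.fib (2 + 1) = 2 := rfl
    omega
  obtain ⟨e, rfl⟩ : ∃ e, k = e + 3 := ⟨k - 3, by omega⟩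
  obtain ⟨n, hn6, hn3, hin, hgi, hr⟩ := FirstMoved.exists_swapRange ⟨hg, hmin, hmem.2, hk, hk', hi⟩
  rw [hin] at hgi
  exact ⟨n, hn6, hn3, hgi, hr⟩

theorem SwapRange.bounds {n N : ℕ} (hn : 6 ≤ n) (hn3 : 3 ∣ n) (h : SwapRange n N) :
    Nat.fib n ≤ N ∧ N < Nat.fib (n + 3) := by
  have h1 := two_mul_fib_div_two hn3
  have e2 : Nat.fib (n + 2) = Nat.fib n + Nat.fib (n + 1) := Nat.fib_add_two
  have e3 : Nat.fib (n + 3) = Nat.fib (n + 1) + Nat.fib (n + 2) := Nat.fib_add_two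
  have h2 := Nat.fib_pos.2 (show 0 < n by omega)
  unfold SwapRange at h
  omega

/-- The intervals `[F_n, F_{n+3})` with `3 ∣ n` are disjoint, so `N` determines `n`. -/
theorem index_unique {n n' N : ℕ} (hn : 3 ∣ n) (hn' : 3 ∣ n') (h : Nat.fib n ≤ N)
    (h' : N < Nat.fib (n + 3)) (k : Nat.fib n' ≤ N) (k' : N < Nat.fib (n' + 3)) : n = n' := by
  have h1 : n < n' + 3 := lt_of_fib_lt (lt_of_le_of_lt h k')
  have h2 : n' < n + 3 := lt_of_fib_lt (lt_of_le_of_lt k h')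
  omega

/-- There is at most one non-trivial automorphism. -/
theorem IsAut.eq_of_ne_one {N : ℕ} {g h : Equiv.Perm ℕ} (hN : 34 ≤ N) (hg : IsAut N g)
    (hh : IsAut N h) (hg1 : g ≠ 1) (hh1 : h ≠ 1) : g = h := by
  obtain ⟨n, hn6, hn3, hgi, hr⟩ := hg.exists_of_ne_one hN hg1
  obtain ⟨n', hn6', hn3', hhi, hr'⟩ := hh.exists_of_ne_one hN hh1
  obtain ⟨b1, b2⟩ := hr.bounds hn6 hn3
  obtain ⟨b1', b2'⟩ := hr'.bounds hn6' hn3'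
  obtain rfl := index_unique hn3 hn3' b1 b2 b1' b2'
  by_contra hne
  -- Both `g` and `h` send `F_n / 2` to `3 F_n / 2`, so `h⁻¹ * g` fixes `F_n / 2`; a non-trivial
  -- automorphism would have to move it.
  have hk1 : h⁻¹ * g ≠ 1 := fun hc => hne (inv_mul_eq_one.1 hc).symm
  obtain ⟨p, hp6, hp3, hpi, hrp⟩ := (hh.inv.mul hg).exists_of_ne_one hN hk1
  obtain ⟨c1, c2⟩ := hrp.bounds hp6 hp3
  obtain rfl := index_unique hn3 hp3 b1 b2 c1 c2
  rw [Equiv.Perm.mul_apply, hgi, Equiv.Perm.inv_eq_iff_eq] at hpi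
  have h0 := h.injective (hhi.trans hpi)
  have h1 := two_mul_fib_div_two hn3
  have h2 := Nat.fib_pos.2 (show 0 < n by omega)
  omega

/-! ### Transfer to automorphisms of the graph. -/

/-- The extension by the identity of an automorphism of `G_N` to a permutation of `ℕ`. -/
def FibSumAut.toPerm {N : ℕ} (φ : FibSumAut N) : Equiv.Perm ℕ :=
  Equiv.Perm.ofSubtype (p := fun x => x ∈ Finset.Icc 1 N) φ.toEquiv

theorem FibSumAut.toPerm_coe {N : ℕ} (φ : FibSumAut N) (v : Finset.Icc 1 N) :
    φ.toPerm v = φ v :=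
  Equiv.Perm.ofSubtype_apply_coe _ _

theorem FibSumAut.toPerm_of_notMem {N : ℕ} (φ : FibSumAut N) {v : ℕ} (hv : v ∉ Finset.Icc 1 N) :
    φ.toPerm v = v :=
  Equiv.Perm.ofSubtype_apply_of_not_mem _ hv

theorem FibSumAut.toPerm_injective {N : ℕ} : Function.Injective (FibSumAut.toPerm (N := N)) := by
  intro φ ψ h
  ext v
  rw [← FibSumAut.toPerm_coe, ← FibSumAut.toPerm_coe, h]

theorem FibSumAut.toPerm_one {N : ℕ} : (1 : FibSumAut N).toPerm = 1 := by
  ext v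
  by_cases hv : v ∈ Finset.Icc 1 N
  · exact FibSumAut.toPerm_coe 1 ⟨v, hv⟩
  · exact FibSumAut.toPerm_of_notMem 1 hv

theorem sumAdj_coe {N : ℕ} (u v : Finset.Icc 1 N) :
    SumAdj N u v ↔ (fibSumGraph N).Adj u v := by
  have hu := Finset.mem_Icc.1 u.2
  have hv := Finset.mem_Icc.1 v.2
  constructor
  · rintro ⟨_, _, _, _, h, hk⟩
    exact ⟨fun hc => h (congrArg _ hc), hk⟩
  · rintro ⟨h, hk⟩
    exact ⟨hu.1, hu.2, hv.1, hv.2, fun hc => h (Subtype.ext hc), hk⟩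

theorem FibSumAut.isAut_toPerm {N : ℕ} (φ : FibSumAut N) : IsAut N φ.toPerm := by
  have hout : ∀ u, ¬(1 ≤ u ∧ u ≤ N) → φ.toPerm u = u := fun u hu =>
    φ.toPerm_of_notMem fun h => hu (Finset.mem_Icc.1 h)
  have hmem : ∀ u, 1 ≤ φ.toPerm u ∧ φ.toPerm u ≤ N → u ∈ Finset.Icc 1 N := by
    intro u hu
    by_contra hc
    rw [φ.toPerm_of_notMem hc] at hu
    exact hc (Finset.mem_Icc.2 hu)
  refine ⟨fun u v => ⟨fun h => ?_, fun h => ?_⟩, hout⟩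
  · have hu : u ∈ Finset.Icc 1 N := Finset.mem_Icc.2 ⟨h.1, h.2.1⟩
    have hv : v ∈ Finset.Icc 1 N := Finset.mem_Icc.2 ⟨h.2.2.1, h.2.2.2.1⟩
    have h' := (sumAdj_coe ⟨u, hu⟩ ⟨v, hv⟩).1 h
    rw [← φ.map_adj_iff, ← sumAdj_coe, ← φ.toPerm_coe, ← φ.toPerm_coe] at h'
    exact h'
  · have hu := hmem u ⟨h.1, h.2.1⟩
    have hv := hmem v ⟨h.2.2.1, h.2.2.2.1⟩
    refine (sumAdj_coe ⟨u, hu⟩ ⟨v, hv⟩).2 ?_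
    rw [← φ.map_adj_iff, ← sumAdj_coe, ← φ.toPerm_coe, ← φ.toPerm_coe]
    exact h

theorem IsAut.exists_fibSumAut {N : ℕ} {g : Equiv.Perm ℕ} (hg : IsAut N g) :
    ∃ φ : FibSumAut N, ∀ v : Finset.Icc 1 N, (φ v : ℕ) = g v := by
  have hmem : ∀ v, v ∈ Finset.Icc 1 N ↔ g v ∈ Finset.Icc 1 N := by
    intro v
    simp only [Finset.mem_Icc]
    refine ⟨fun h => hg.mem h.1 h.2, fun h => ?_⟩
    simpa using hg.inv.mem h.1 h.2
  refine ⟨⟨g.subtypeEquiv hmem, ?_⟩, fun v => rfl⟩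
  intro u v
  rw [← sumAdj_coe, ← sumAdj_coe]
  exact (hg.1 u v).symm

theorem FibSumAut.eq_of_ne_one {N : ℕ} (hN : 34 ≤ N) {φ ψ : FibSumAut N} (hφ : φ ≠ 1)
    (hψ : ψ ≠ 1) : φ = ψ := by
  refine FibSumAut.toPerm_injective (φ.isAut_toPerm.eq_of_ne_one hN ψ.isAut_toPerm ?_ ?_)
  · exact fun h => hφ (FibSumAut.toPerm_injective (h.trans FibSumAut.toPerm_one.symm))
  · exact fun h => hψ (FibSumAut.toPerm_injective (h.trans FibSumAut.toPerm_one.symm))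

/-- If `g` preserves `G_N` and moves a vertex, then its restriction is the only non-trivial
automorphism. -/
theorem IsAut.exists_univ_eq {N : ℕ} {g : Equiv.Perm ℕ} (hN : 34 ≤ N) (hg : IsAut N g) {i : ℕ}
    (h1 : 1 ≤ i) (h2 : i ≤ N) (hi : g i ≠ i) :
    ∃ φ : FibSumAut N, φ ≠ 1 ∧ (∀ v : Finset.Icc 1 N, (φ v : ℕ) = g v) ∧
      (Set.univ : Set (FibSumAut N)) = {1, φ} := by
  obtain ⟨φ, hφ⟩ := hg.exists_fibSumAut
  have hne : φ ≠ 1 := by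
    rintro rfl
    exact hi (hφ ⟨i, Finset.mem_Icc.2 ⟨h1, h2⟩⟩).symm
  refine ⟨φ, hne, hφ, ?_⟩
  symm
  rw [Set.eq_univ_iff_forall]
  intro ψ
  by_cases h : ψ = 1
  · exact Or.inl h
  · exact Or.inr (FibSumAut.eq_of_ne_one hN h hne)

theorem FibSumAut.univ_eq_one {n N : ℕ} (hN : 34 ≤ N) (hn3 : 3 ∣ n) (h : Nat.fib n ≤ N)
    (h' : N < Nat.fib (n + 3)) (hr : ¬SwapRange n N) : (Set.univ : Set (FibSumAut N)) = {1} := by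
  symm
  rw [Set.eq_univ_iff_forall]
  intro ψ
  by_contra hc
  have hψ : ψ.toPerm ≠ 1 := fun h =>
    hc (FibSumAut.toPerm_injective (h.trans FibSumAut.toPerm_one.symm))
  obtain ⟨p, hp6, hp3, -, hrp⟩ := ψ.isAut_toPerm.exists_of_ne_one hN hψ
  obtain ⟨c1, c2⟩ := hrp.bounds hp6 hp3
  obtain rfl := index_unique hn3 hp3 h h' c1 c2
  exact hr hrp

/-! ### The classification. -/

theorem mainTheorem1 :
    (∀ n : ℕ, 9 ≤ n → 3 ∣ n → ∀ N : ℕ,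
      (N ∈ Set.Ico (Nat.fib n) (3 * (Nat.fib n / 2)) ∪
            Set.Ico (Nat.fib (n + 3) / 2) (Nat.fib (n + 2) + Nat.fib (n - 3) / 2) ∪
            Set.Ico (Nat.fib (n + 3) - Nat.fib n / 2) (Nat.fib (n + 3)) →
        (Set.univ : Set (FibSumAut N)) = {1}) ∧
      (N ∈ Set.Ico (3 * (Nat.fib n / 2)) (Nat.fib (n + 3) / 2) →
        ∃ φ : FibSumAut N,
          φ ≠ 1 ∧
          (∀ v : Finset.Icc 1 N,
            (φ v : ℕ) = Equiv.swap (Nat.fib n / 2) (3 * (Nat.fib n / 2)) (v : ℕ)) ∧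
          (Set.univ : Set (FibSumAut N)) = {1, φ}) ∧
      (N ∈ Set.Ico (Nat.fib (n + 2) + Nat.fib (n - 3) / 2) (Nat.fib (n + 3) - Nat.fib n / 2) →
        ∃ φ : FibSumAut N,
          φ ≠ 1 ∧
          (∀ v : Finset.Icc 1 N,
            (φ v : ℕ) =
              Equiv.swap (Nat.fib n / 2) (3 * (Nat.fib n / 2))
                (Equiv.swap (Nat.fib (n + 2) + Nat.fib (n - 3) / 2) (Nat.fib (n + 3) / 2)
                  (v : ℕ))) ∧
          (Set.univ : Set (FibSumAut N)) = {1, φ})) ∧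
    (∀ N : ℕ, 34 ≤ N → ∀ φ ψ : FibSumAut N, φ ≠ 1 → ψ ≠ 1 → φ = ψ) := by
  refine ⟨fun n hn9 hn3 N => ?_, fun N hN φ ψ hφ hψ => FibSumAut.eq_of_ne_one hN hφ hψ⟩
  have h34 : 34 ≤ Nat.fib n := Nat.fib_mono hn9
  have hh := two_mul_fib_div_two hn3
  have hh3 := two_mul_fib_div_two (show 3 ∣ n + 3 by omega)
  have hhm := two_mul_fib_div_two (show 3 ∣ n - 3 by omega)
  -- With this shift `F_n / 2` lies in the block `[F_{e+3}, F_{e+4})`.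
  obtain ⟨e, rfl⟩ : ∃ e, n = e + 5 := ⟨n - 5, by omega⟩
  rw [show e + 5 - 3 = e + 2 by omega] at *
  simp only [add_assoc, Nat.reduceAdd] at *
  have e4 : Nat.fib (e + 4) = Nat.fib (e + 2) + Nat.fib (e + 3) := Nat.fib_add_two
  have e5 : Nat.fib (e + 5) = Nat.fib (e + 3) + Nat.fib (e + 4) := Nat.fib_add_two
  have e6 : Nat.fib (e + 6) = Nat.fib (e + 4) + Nat.fib (e + 5) := Nat.fib_add_two
  have e7 : Nat.fib (e + 7) = Nat.fib (e + 5) + Nat.fib (e + 6) := Nat.fib_add_two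
  have e8 : Nat.fib (e + 8) = Nat.fib (e + 6) + Nat.fib (e + 7) := Nat.fib_add_two
  generalize hi : Nat.fib (e + 5) / 2 = i at *
  generalize hq : Nat.fib (e + 8) / 2 = q at *
  generalize ha : Nat.fib (e + 2) / 2 = a at *
  refine ⟨fun hN => ?_, fun hN => ?_, fun hN => ?_⟩
  · simp only [Set.mem_union, Set.mem_Ico] at hN
    have hb : Nat.fib (e + 5) ≤ N ∧ N < Nat.fib (e + 5 + 3) := by
      simp only [add_assoc, Nat.reduceAdd]
      omega
    refine FibSumAut.univ_eq_one (by omega) hn3 hb.1 hb.2 fun hr => ?_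
    unfold SwapRange at hr
    rw [show e + 5 - 3 = e + 2 by omega] at hr
    simp only [add_assoc, Nat.reduceAdd] at hr
    rw [hi, hq, ha] at hr
    omega
  · rw [Set.mem_Ico] at hN
    have hg := isAut_swap (N := N) hh.symm hN.1 (by omega)
    refine hg.exists_univ_eq (by omega) (show 1 ≤ i by omega) (by omega) ?_
    rw [Equiv.swap_apply_left]
    omega
  · rw [Set.mem_Ico] at hN
    -- The required `p + 3i = F_{e+8}` holds because `F_{n+3} - 3 F_n / 2 = F_{n+2} + F_{n-3} / 2`.
    have hg := isAut_double_swap (N := N) (p := Nat.fib (e + 7) + a) (q := q) hh.symm (by omega)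
      hh3 hN.1 (by omega)
    refine hg.exists_univ_eq (by omega) (show 1 ≤ i by omega) (by omega) ?_
    rw [Equiv.Perm.mul_apply,
      Equiv.swap_apply_of_ne_of_ne (b := q) (by omega) (by omega),
      Equiv.swap_apply_left]
    omega
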